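/- Let $b>1$ be an integer and let $A\subset\{0,1,\dots,b-1\}$ be a set of digits containing at least one non-zero digit; put $N=\#A$. Call a non-negative integer $n$ admissible if all digits of its minimal $b$-ary representation belong to $A$, and let $\ell(n)$ be the number of digits of that representation (so $\ell(0)=0$). The Dirichlet series $K(s)=\sum n^{-s}$, where the sum runs over all admissible integers $n>0$, converges absolutely for $\Re s>\log_b N$ and extends to a meromorphic function, still denoted $K$, on the whole complex plane. For every $k\in\mathbb Z$, put $$s_{0,k}=\log_b N+\frac{2\pi i k}{\log b}.$$ Then the limit below exists and the residue of $K$ at $s_{0,k}$ (understood as $0$ if $K$ has no pole there) is $$\operatorname{Res}_{s=s_{0,k}}K(s)=\frac1{\log b}\,\lim_{\ell\to\infty}\ \sum_{\substack{n\text{ admissible}\\ \ell(n)=\ell}}\frac1{n^{s_{0,k}}}.$$ -/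

import Mathlib

open Filter Topology

namespace RestrictedDirichlet

/-- All digits of the minimal `b`-ary representation of `n` belong to `A`. -/
def Admissible (b : ℕ) (A : Finset ℕ) (n : ℕ) : Prop :=
  ∀ d ∈ Nat.digits b n, d ∈ A

/-- The number of digits of the minimal `b`-ary representation of `n` (so `0` has length `0`). -/
def len (b n : ℕ) : ℕ := (Nat.digits b n).length

open Classical in
/-- The finite set of admissible integers of length `l`. -/
noncomputable def block (b : ℕ) (A : Finset ℕ) (l : ℕ) : Finset ℕ :=
  (Finset.range (b ^ l)).filter fun n => len b n = l ∧ Admissible b A n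

/-- For `b > 1` the bound `n < b ^ l` in the definition of `block` excludes nothing. -/
theorem mem_block {b : ℕ} (hb : 1 < b) (A : Finset ℕ) (l n : ℕ) :
    n ∈ block b A l ↔ len b n = l ∧ Admissible b A n := by
  classical
  unfold block
  rw [Finset.mem_filter, Finset.mem_range]
  refine ⟨fun h => h.2, fun h => ⟨?_, h⟩⟩
  rw [← h.1]
  exact Nat.lt_base_pow_length_digits hb

/-- `f` is a meromorphic function on the whole complex plane which is, on the half-plane
`Re s > log_b N` with `N = #A`, the sum of the series of `n ^ (-s)` over all positive admissible
integers `n`. -/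
def IsMeromorphicContinuation (b : ℕ) (A : Finset ℕ) (f : ℂ → ℂ) : Prop :=
  Meromorphic f ∧
    ∀ s : ℂ, Real.logb b A.card < s.re →
      HasSum (fun n : {n : ℕ // 0 < n ∧ Admissible b A n} => ((n : ℕ) : ℂ) ^ (-s)) (f s)

/-- `c` is the residue at `z` of the function `f`, meromorphic at `z`: the integral of `f` over
every sufficiently small positively oriented circle centred at `z` is `2πi c`. -/
def HasResidueAt (f : ℂ → ℂ) (z c : ℂ) : Prop :=
  MeromorphicAt f z ∧
    ∀ᶠ r : ℝ in 𝓝[>] 0, (∮ w in C(z, r), f w) = 2 * Real.pi * Complex.I * c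

/-- The point `log_b N + 2πik / log b` with `N = #A`. -/
noncomputable def poleZero (b : ℕ) (A : Finset ℕ) (k : ℤ) : ℂ :=
  (Real.logb b A.card : ℂ) + 2 * Real.pi * Complex.I * k / (Real.log b : ℂ)

end RestrictedDirichlet

namespace RestrictedDirichlet

/-! A positive admissible integer is either a non-zero digit or `a + b * m` with `a ∈ A` and `m`
positive admissible. Expanding `(a + b * m) ^ (-s) = (b * m) ^ (-s) * (1 + a / (b * m)) ^ (-s)`
binomially and summing over `a`, the leading term is `N b ^ (-s) m ^ (-s)`, so `(1 - N b ^ (-s))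
K(s) = numer(s)`, where `numer` involves only terms of order `m ^ (-s - 1)` and is holomorphic for
`Re s > log_b N - 1` (`denom_mul_series`, `analyticAt_numer`).

Continuation: the remainder is again a series `∑ n ^ (-s) ∑ c_j(s) n ^ (-j)`, evaluated at `s + 1`.
Splitting off its leading term leaves a multiple of `K` and another such series, so each round gains
a strip of width one (`continuation`, `continuation_succ_eq`).

Residue: `denom` has a simple zero at `s_{0,k}` with derivative `log b`, so the residue is `numer /
log b`. The digit recursion for finite sums shows that the block sums tend to the same `numer`
(`tendsto_sum_block`), since there `N b ^ (-s) = 1` and the leading terms cancel. -/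

variable {b : ℕ} {A : Finset ℕ}

/-! ### Digit recursion for admissible integers -/

open Classical in
/-- The finite set of positive admissible integers with at most `l` digits. -/
noncomputable def upTo (b : ℕ) (A : Finset ℕ) (l : ℕ) : Finset ℕ :=
  (Finset.range (b ^ l)).filter fun n => 0 < n ∧ Admissible b A n

theorem mem_upTo {l n : ℕ} : n ∈ upTo b A l ↔ n < b ^ l ∧ 0 < n ∧ Admissible b A n := by
  simp [upTo]

theorem admissible_add_mul (hb : 1 < b) {a m : ℕ} (ha : a < b) (h : a ≠ 0 ∨ m ≠ 0) :
    Admissible b A (a + b * m) ↔ a ∈ A ∧ Admissible b A m := by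
  unfold Admissible
  rw [Nat.digits_add b hb a m ha h]
  simp

theorem admissible_zero : Admissible b A 0 := by simp [Admissible]

theorem upTo_succ (hb : 1 < b) (hAb : ∀ a ∈ A, a < b) (l : ℕ) :
    upTo b A (l + 1) =
      A.erase 0 ∪ (upTo b A l ×ˢ A).image fun p => p.2 + b * p.1 := by
  ext n
  simp only [Finset.mem_union, Finset.mem_image, Finset.mem_product, Prod.exists, mem_upTo,
    Finset.mem_erase]
  constructor
  · rintro ⟨hlt, hpos, hn⟩
    have hdec : n % b + b * (n / b) = n := Nat.mod_add_div n b
    have hmod : n % b < b := Nat.mod_lt _ (by omega)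
    rw [← hdec, admissible_add_mul hb hmod
      (by by_contra! h; rw [h.1, h.2] at hdec; omega)] at hn
    rcases Nat.eq_zero_or_pos (n / b) with h0 | h0
    · left
      rw [h0, mul_zero, add_zero] at hdec
      exact ⟨hpos.ne', hdec ▸ hn.1⟩
    · right
      exact ⟨n / b, n % b, ⟨⟨Nat.div_lt_of_lt_mul (by rwa [pow_succ'] at hlt), h0, hn.2⟩, hn.1⟩, hdec⟩
  · rintro (⟨h0, hn⟩ | ⟨m, a, ⟨⟨hlt, hpos, hm⟩, ha⟩, rfl⟩)
    · refine ⟨(hAb n hn).trans_le (Nat.le_self_pow (by omega) b), by omega, ?_⟩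
      have := (admissible_add_mul (A := A) hb (hAb n hn) (m := 0) (.inl h0)).2 ⟨hn, admissible_zero⟩
      simpa using this
    · refine ⟨?_, by positivity, (admissible_add_mul hb (hAb a ha) (.inr hpos.ne')).2 ⟨ha, hm⟩⟩
      have := hAb a ha
      rw [pow_succ']
      nlinarith

/-- Splitting off the last digit; excluding `m = 0` from the second sum keeps the decomposition
disjoint. -/
theorem sum_upTo_succ {E : Type*} [AddCommMonoid E] (hb : 1 < b) (hAb : ∀ a ∈ A, a < b) (F : ℕ → E)
    (l : ℕ) :
    ∑ n ∈ upTo b A (l + 1), F n =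
      ∑ a ∈ A.erase 0, F a + ∑ m ∈ upTo b A l, ∑ a ∈ A, F (a + b * m) := by
  rw [upTo_succ hb hAb, Finset.sum_union, Finset.sum_image, Finset.sum_product]
  · rintro ⟨m, a⟩ h ⟨m', a'⟩ h' heq
    simp only [Finset.coe_product, Set.mem_prod, Finset.mem_coe] at h h'
    have h1 := hAb a h.2
    have h2 := hAb a' h'.2
    simp only at heq
    have e1 : a = a' := by
      have := congrArg (· % b) heq
      simpa [Nat.mod_eq_of_lt h1, Nat.mod_eq_of_lt h2] using this
    subst e1
    have : b * m = b * m' := by omega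
    rw [Nat.eq_of_mul_eq_mul_left (by omega) this]
  · rw [Finset.disjoint_left]
    intro n hn hn'
    simp only [Finset.mem_image, Finset.mem_product, Prod.exists, mem_upTo] at hn'
    obtain ⟨m, a, ⟨⟨-, hpos, -⟩, -⟩, rfl⟩ := hn'
    have := hAb _ (Finset.mem_of_mem_erase hn)
    nlinarith

theorem sum_upTo_succ_eq_add_block {E : Type*} [AddCommMonoid E] (hb : 1 < b) (F : ℕ → E)
    (l : ℕ) :
    ∑ n ∈ upTo b A (l + 1), F n = ∑ n ∈ upTo b A l, F n + ∑ n ∈ block b A (l + 1), F n := by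
  rw [← Finset.sum_union]
  · congr 1
    ext n
    simp only [Finset.mem_union, mem_upTo, mem_block hb, len]
    have h1 := Nat.digits_length_le_iff hb n (k := l)
    have h2 := Nat.digits_length_le_iff hb n (k := l + 1)
    have h3 : 0 < n ∨ (Nat.digits b n).length = 0 := by
      rcases Nat.eq_zero_or_pos n with rfl | h
      · simp
      · exact .inl h
    rw [← h1, ← h2]
    grind
  · rw [Finset.disjoint_left]
    intro n hn hn'
    rw [mem_upTo, ← Nat.digits_length_le_iff hb] at hn
    rw [mem_block hb, len] at hn'
    omega

/-! ### Sums over admissible integers and absolute convergence -/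

/-- The positive admissible integers. -/
abbrev Pos (b : ℕ) (A : Finset ℕ) : Type := {n : ℕ // 0 < n ∧ Admissible b A n}

theorem tendsto_sum_upTo {E : Type*} [NormedAddCommGroup E] (hb : 1 < b) {F : ℕ → E}
    (hF : Summable fun n : Pos b A => F n) :
    Tendsto (fun l => ∑ n ∈ upTo b A l, F n) atTop (𝓝 (∑' n : Pos b A, F n)) := by
  classical
  have h := (hasSum_subtype_iff_indicator (s := {n | 0 < n ∧ Admissible b A n}).1
    hF.hasSum).tendsto_sum_nat.comp (tendsto_pow_atTop_atTop_of_one_lt hb)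
  refine h.congr fun l => ?_
  simp [upTo, Finset.sum_filter, Set.indicator_apply]

theorem summable_of_sum_upTo_le (hb : 1 < b) {F : ℕ → ℝ} (hF : ∀ n, 0 ≤ F n) {C : ℝ}
    (h : ∀ l, ∑ n ∈ upTo b A l, F n ≤ C) : Summable fun n : Pos b A => F n := by
  classical
  refine summable_of_sum_le (c := C) (fun n => hF n) fun u => ?_
  obtain ⟨l, hl⟩ : ∃ l, u.map (Function.Embedding.subtype _) ⊆ upTo b A l := by
    -- The maximum of `u` serves as the number of digits, because `n < b ^ n`.
    refine ⟨(u.map (Function.Embedding.subtype _)).sup id, fun n hn => ?_⟩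
    have hle : n ≤ (u.map (Function.Embedding.subtype _)).sup id := Finset.le_sup (f := id) hn
    rw [Finset.mem_map] at hn
    obtain ⟨x, -, rfl⟩ := hn
    exact mem_upTo.2 ⟨hle.trans_lt (Nat.lt_pow_self hb), x.2⟩
  calc ∑ x ∈ u, F x = ∑ n ∈ u.map (Function.Embedding.subtype _), F n := by simp
    _ ≤ ∑ n ∈ upTo b A l, F n := Finset.sum_le_sum_of_subset_of_nonneg hl fun n _ _ => hF n
    _ ≤ C := h l

theorem card_mul_rpow_lt_one (hb : 1 < b) (hA : 0 < A.card) {σ : ℝ} (hσ : Real.logb b A.card < σ) :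
    A.card * (b : ℝ) ^ (-σ) < 1 := by
  have hb' : (1 : ℝ) < b := by exact_mod_cast hb
  have h := (Real.logb_lt_iff_lt_rpow hb' (by exact_mod_cast hA)).1 hσ
  rw [Real.rpow_neg (by positivity), ← div_eq_mul_inv, div_lt_one (by positivity)]
  exact h

theorem logb_card_nonneg (hb : 1 < b) : 0 ≤ Real.logb b A.card := by
  rcases Nat.eq_zero_or_pos A.card with h | h
  · simp [h]
  · exact Real.logb_nonneg (by exact_mod_cast hb) (by exact_mod_cast h)

/-- Dropping `a` from `a + b * m` turns the digit recursion into `S (l + 1) ≤ C + q * S l` with `q =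
N b ^ (-σ) < 1`. -/
theorem summable_rpow (hb : 1 < b) (hAb : ∀ a ∈ A, a < b) (hA : 0 < A.card) {σ : ℝ}
    (hσ : Real.logb b A.card < σ) : Summable fun n : Pos b A => ((n : ℕ) : ℝ) ^ (-σ) := by
  have hσ0 : 0 < σ := (logb_card_nonneg hb).trans_lt hσ
  have hq := card_mul_rpow_lt_one hb hA hσ
  set q : ℝ := A.card * (b : ℝ) ^ (-σ) with hqdef
  set C : ℝ := ∑ a ∈ A.erase 0, (a : ℝ) ^ (-σ) with hC
  have hC0 : 0 ≤ C := Finset.sum_nonneg fun a _ => by positivity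
  refine summable_of_sum_upTo_le hb (F := fun n => (n : ℝ) ^ (-σ)) (fun n => by positivity)
    (C := C / (1 - q)) fun l => ?_
  induction l with
  | zero =>
    have : upTo b A 0 = ∅ := by
      ext n
      simp only [mem_upTo, pow_zero, Finset.notMem_empty, iff_false]
      omega
    rw [this, Finset.sum_empty]
    exact div_nonneg hC0 (by linarith)
  | succ l ih =>
    rw [sum_upTo_succ hb hAb]
    have hstep : ∑ m ∈ upTo b A l, ∑ a ∈ A, ((a + b * m : ℕ) : ℝ) ^ (-σ) ≤
        q * ∑ m ∈ upTo b A l, (m : ℝ) ^ (-σ) := by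
      rw [Finset.mul_sum]
      refine Finset.sum_le_sum fun m hm => ?_
      have hm0 : (0 : ℝ) < m := by exact_mod_cast (mem_upTo.1 hm).2.1
      have hb0 : (0 : ℝ) < b := by positivity
      calc ∑ a ∈ A, ((a + b * m : ℕ) : ℝ) ^ (-σ) ≤ ∑ a ∈ A, ((b : ℝ) * m) ^ (-σ) := by
            refine Finset.sum_le_sum fun a _ => ?_
            refine Real.rpow_le_rpow_of_nonpos (by positivity) ?_ (by linarith)
            push_cast
            have : (0 : ℝ) ≤ a := by positivity
            linarith
        _ = q * (m : ℝ) ^ (-σ) := by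
            rw [Finset.sum_const, nsmul_eq_mul, Real.mul_rpow hb0.le hm0.le, hqdef]
            ring
    -- The bound is the fixed point of `x ↦ C + q * x`, hence stable under the recursion.
    have h1 : C / (1 - q) = C + q * (C / (1 - q)) := by
      have : 1 - q ≠ 0 := by linarith
      field_simp
      ring
    rw [h1]
    have hq0 : 0 ≤ q := mul_nonneg (Nat.cast_nonneg _) (Real.rpow_nonneg (Nat.cast_nonneg _) _)
    exact add_le_add le_rfl (hstep.trans (mul_le_mul_of_nonneg_left ih hq0))

/-! ### Dirichlet series with expansions in inverse powers of `n` -/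

/-- Sequences of entire functions which are summable uniformly on bounded sets. -/
structure IsCoeff (c : ℕ → ℂ → ℂ) : Prop where
  differentiable : ∀ j, Differentiable ℂ (c j)
  bound : ∀ R : ℝ, ∃ u : ℕ → ℝ, Summable u ∧ ∀ j s, ‖s‖ ≤ R → ‖c j s‖ ≤ u j

/-- The coefficients of the expansion with its leading term removed, with argument shifted. -/
def shift (c : ℕ → ℂ → ℂ) : ℕ → ℂ → ℂ := fun j s => c (j + 1) (s - 1)

theorem IsCoeff.shift {c : ℕ → ℂ → ℂ} (hc : IsCoeff c) : IsCoeff (shift c) where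
  differentiable j := (hc.differentiable (j + 1)).comp (differentiable_id.sub_const 1)
  bound R := by
    obtain ⟨u, hu, h⟩ := hc.bound (R + 1)
    refine ⟨fun j => u (j + 1), (summable_nat_add_iff 1).2 hu, fun j s hs => h _ _ ?_⟩
    calc ‖s - 1‖ ≤ ‖s‖ + ‖(1 : ℂ)‖ := norm_sub_le _ _
      _ ≤ R + 1 := by rw [norm_one]; linarith

/-- The coefficients of the constant function `1`. -/
def unitCoeff : ℕ → ℂ → ℂ := fun j _ => if j = 0 then 1 else 0

theorem isCoeff_unitCoeff : IsCoeff unitCoeff where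
  differentiable j := differentiable_const _
  bound R := by
    refine ⟨fun j => if j = 0 then 1 else 0,
      summable_of_ne_finset_zero (s := {0}) (by simp), fun j s _ => ?_⟩
    unfold unitCoeff
    split_ifs <;> simp [*]

/-- The term `n ^ (-s) * ∑ c_j(s) n ^ (-j)`. -/
noncomputable def term (c : ℕ → ℂ → ℂ) (n : ℕ) (s : ℂ) : ℂ :=
  (n : ℂ) ^ (-s) * ∑' j, c j s * ((n : ℂ)⁻¹) ^ j

theorem norm_inv_natCast_pow_le {n : ℕ} (j : ℕ) : ‖((n : ℂ)⁻¹) ^ j‖ ≤ 1 := by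
  rw [norm_pow, norm_inv, Complex.norm_natCast]
  refine pow_le_one₀ (by positivity) ?_
  rcases Nat.eq_zero_or_pos n with rfl | hn
  · simp
  · exact inv_le_one_of_one_le₀ (by exact_mod_cast hn)

theorem IsCoeff.norm_mul_pow_le {c : ℕ → ℂ → ℂ} {u : ℕ → ℝ} {R : ℝ}
    (h : ∀ j s, ‖s‖ ≤ R → ‖c j s‖ ≤ u j) (n j : ℕ) {s : ℂ} (hs : ‖s‖ ≤ R) :
    ‖c j s * ((n : ℂ)⁻¹) ^ j‖ ≤ u j := by
  rw [norm_mul]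
  exact (mul_le_of_le_one_right (norm_nonneg _) (norm_inv_natCast_pow_le j)).trans (h j s hs)

theorem IsCoeff.summable {c : ℕ → ℂ → ℂ} (hc : IsCoeff c) (n : ℕ) (s : ℂ) :
    Summable fun j => c j s * ((n : ℂ)⁻¹) ^ j := by
  obtain ⟨u, hu, h⟩ := hc.bound ‖s‖
  exact Summable.of_norm_bounded hu fun j => IsCoeff.norm_mul_pow_le h n j le_rfl

theorem IsCoeff.norm_term_le {c : ℕ → ℂ → ℂ} {u : ℕ → ℝ} {R : ℝ} (hu : Summable u)
    (h : ∀ j s, ‖s‖ ≤ R → ‖c j s‖ ≤ u j) {n : ℕ} (hn : 0 < n) {s : ℂ} (hs : ‖s‖ ≤ R)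
    {σ : ℝ} (hσ : σ ≤ s.re) : ‖term c n s‖ ≤ (n : ℝ) ^ (-σ) * ∑' j, u j := by
  rw [term, norm_mul, Complex.norm_natCast_cpow_of_pos hn]
  refine mul_le_mul ?_ (tsum_of_norm_bounded hu.hasSum fun j => IsCoeff.norm_mul_pow_le h n j hs)
    (norm_nonneg _) (by positivity)
  exact Real.rpow_le_rpow_of_exponent_le (by exact_mod_cast hn) (by simpa using hσ)

theorem IsCoeff.summable_term (hb : 1 < b) (hAb : ∀ a ∈ A, a < b) (hA : 0 < A.card)
    {c : ℕ → ℂ → ℂ} (hc : IsCoeff c) {s : ℂ} (hs : Real.logb b A.card < s.re) :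
    Summable fun n : Pos b A => term c n s := by
  obtain ⟨u, hu, h⟩ := hc.bound ‖s‖
  exact Summable.of_norm_bounded ((summable_rpow hb hAb hA hs).mul_right _) fun n =>
    IsCoeff.norm_term_le hu h n.2.1 le_rfl le_rfl

theorem IsCoeff.differentiable_term {c : ℕ → ℂ → ℂ} (hc : IsCoeff c) {n : ℕ} (hn : 0 < n) :
    Differentiable ℂ (term c n) := by
  have hn' : (n : ℂ) ≠ 0 := by exact_mod_cast hn.ne'
  refine Differentiable.mul (fun s => ?_) fun s => ?_
  · exact (differentiableAt_id.neg).const_cpow (.inl hn')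
  · obtain ⟨u, hu, h⟩ := hc.bound (‖s‖ + 1)
    have hd : DifferentiableOn ℂ (fun s => ∑' j, c j s * ((n : ℂ)⁻¹) ^ j)
        (Metric.ball 0 (‖s‖ + 1)) :=
      Complex.differentiableOn_tsum_of_summable_norm hu
        (fun j => ((hc.differentiable j).mul_const _).differentiableOn) Metric.isOpen_ball
        fun j w hw => IsCoeff.norm_mul_pow_le h n j (mem_ball_zero_iff.1 hw).le
    exact hd.differentiableAt (Metric.isOpen_ball.mem_nhds (by simp))

/-- The sum `∑ n ^ (-s) * ∑ c_j(s) n ^ (-j)` over all positive admissible `n`. -/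
noncomputable def series (b : ℕ) (A : Finset ℕ) (c : ℕ → ℂ → ℂ) (s : ℂ) : ℂ :=
  ∑' n : Pos b A, term c n s

theorem IsCoeff.differentiableOn_series (hb : 1 < b) (hAb : ∀ a ∈ A, a < b) (hA : 0 < A.card)
    {c : ℕ → ℂ → ℂ} (hc : IsCoeff c) :
    DifferentiableOn ℂ (series b A c) {s | Real.logb b A.card < s.re} := by
  intro s hs
  obtain ⟨σ, h1, h2⟩ := exists_between (show Real.logb b A.card < s.re from hs)
  obtain ⟨u, hu, h⟩ := hc.bound (‖s‖ + 1)
  have hU : IsOpen (Metric.ball (0 : ℂ) (‖s‖ + 1) ∩ {s | σ < s.re}) :=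
    Metric.isOpen_ball.inter (isOpen_lt continuous_const Complex.continuous_re)
  have hd : DifferentiableOn ℂ (series b A c) (Metric.ball (0 : ℂ) (‖s‖ + 1) ∩ {s | σ < s.re}) :=
    Complex.differentiableOn_tsum_of_summable_norm ((summable_rpow hb hAb hA h1).mul_right _)
      (fun n => (hc.differentiable_term n.2.1).differentiableOn) hU
      fun n w hw => IsCoeff.norm_term_le hu h n.2.1 (mem_ball_zero_iff.1 hw.1).le (le_of_lt hw.2)
  exact (hd.differentiableAt (hU.mem_nhds ⟨by simp, h2⟩)).differentiableWithinAt

theorem term_unitCoeff (n : ℕ) (s : ℂ) : term unitCoeff n s = (n : ℂ) ^ (-s) := by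
  rw [term, tsum_eq_single 0 (by intro j hj; simp [unitCoeff, hj])]
  simp [unitCoeff]

/-- A factor `n⁻¹` taken out of the tail moves the argument to `s + 1`; the `s - 1` in `shift`
compensates for this in the coefficients. -/
theorem IsCoeff.term_eq {c : ℕ → ℂ → ℂ} (hc : IsCoeff c) {n : ℕ} (hn : 0 < n) (s : ℂ) :
    term c n s = c 0 s * (n : ℂ) ^ (-s) + term (RestrictedDirichlet.shift c) n (s + 1) := by
  have hn' : (n : ℂ) ≠ 0 := by exact_mod_cast hn.ne'
  rw [term, term, (hc.summable n s).tsum_eq_zero_add, neg_add, Complex.cpow_add _ _ hn',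
    Complex.cpow_neg_one, mul_assoc, ← tsum_mul_left (a := (n : ℂ)⁻¹), mul_add, pow_zero, mul_one,
    mul_comm (c 0 s)]
  congr 3
  ext j
  simp only [RestrictedDirichlet.shift, add_sub_cancel_right, pow_succ]
  ring

theorem IsCoeff.series_eq (hb : 1 < b) (hAb : ∀ a ∈ A, a < b) (hA : 0 < A.card)
    {c : ℕ → ℂ → ℂ} (hc : IsCoeff c) {s : ℂ} (hs : Real.logb b A.card < s.re) :
    series b A c s =
      c 0 s * series b A unitCoeff s + series b A (RestrictedDirichlet.shift c) (s + 1) := by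
  have h1 := isCoeff_unitCoeff.summable_term hb hAb hA hs
  have h2 := hc.shift.summable_term hb hAb hA (s := s + 1) (by simp; linarith)
  unfold series
  rw [← tsum_mul_left, ← (h1.mul_left _).tsum_add h2]
  exact tsum_congr fun n => by rw [hc.term_eq n.2.1, term_unitCoeff]

/-! ### Binomial expansion of the sum over the last digit -/

/-- The binomial coefficient `-s` over `j`. -/
noncomputable def negChoose : ℕ → ℂ → ℂ
  | 0, _ => 1
  | j + 1, s => negChoose j s * ((-s - j) / (j + 1))

theorem negChoose_eq (j : ℕ) (s : ℂ) : negChoose j s = Ring.choose (-s) j := by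
  induction j with
  | zero => simp [negChoose]
  | succ j ih =>
    rw [negChoose, ih, Ring.choose_eq_smul, Ring.choose_eq_smul, descPochhammer_succ_right,
      Polynomial.smeval_mul]
    simp only [Polynomial.smeval_sub, Polynomial.smeval_X, Polynomial.smeval_natCast,
      Nat.factorial_succ, smul_eq_mul, pow_one, pow_zero, nsmul_eq_mul, mul_one]
    have : ((j : ℂ) + 1) ≠ 0 := Nat.cast_add_one_ne_zero j
    have : ((j.factorial : ℕ) : ℂ) ≠ 0 := by exact_mod_cast j.factorial_ne_zero
    push_cast
    field_simp

theorem differentiable_negChoose (j : ℕ) : Differentiable ℂ (negChoose j) := by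
  induction j with
  | zero => exact differentiable_const 1
  | succ j ih =>
    exact ih.mul ((differentiable_id.neg.sub_const _).div_const _)

/-- The growth is polynomial in `j`, so the geometric factors `(a / b) ^ j` give summability. -/
theorem norm_negChoose_le {R : ℕ} {s : ℂ} (hs : ‖s‖ ≤ R) (j : ℕ) :
    ‖negChoose j s‖ ≤ ((j + R).choose R : ℝ) := by
  induction j with
  | zero => simp [negChoose]
  | succ j ih =>
    have hrec : (((j + 1 + R).choose R : ℕ) : ℝ) = ((j + R).choose R : ℝ) * ((j + 1 + R) / (j + 1)) := by
      have h := Nat.add_one_mul_choose_eq (j + R) j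
      rw [Nat.choose_symm_add, show j + R + 1 = (j + 1) + R by ring, Nat.choose_symm_add] at h
      have h' : ((j : ℝ) + 1 + R) * ((j + R).choose R : ℝ) =
        ((j + 1 + R).choose R : ℝ) * (j + 1) := by exact_mod_cast h
      field_simp
      linarith
    rw [negChoose, norm_mul, hrec]
    refine mul_le_mul ih ?_ (norm_nonneg _) (by positivity)
    rw [norm_div, show ((j : ℂ) + 1) = ((j + 1 : ℕ) : ℂ) by push_cast; ring, Complex.norm_natCast]
    push_cast
    gcongr
    calc ‖-s - j‖ ≤ ‖-s‖ + ‖(j : ℂ)‖ := norm_sub_le _ _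
      _ ≤ j + 1 + R := by rw [norm_neg, Complex.norm_natCast]; linarith

/-- The coefficients of `∑_{a ∈ A} (1 + a x / b) ^ (-s)` in powers of `x`. -/
noncomputable def digitCoeff (b : ℕ) (A : Finset ℕ) : ℕ → ℂ → ℂ :=
  fun j s => ∑ a ∈ A, negChoose j s * ((a : ℂ) / b) ^ j

theorem digitCoeff_zero (s : ℂ) : digitCoeff b A 0 s = A.card := by
  simp [digitCoeff, negChoose]

theorem isCoeff_digitCoeff (hb : 1 < b) (hAb : ∀ a ∈ A, a < b) : IsCoeff (digitCoeff b A) where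
  differentiable j := by
    unfold digitCoeff
    exact Differentiable.fun_sum fun a _ => (differentiable_negChoose j).mul_const _
  bound R := by
    have hb0 : (0 : ℝ) < b := by positivity
    refine ⟨fun j => ∑ a ∈ A, ((j + ⌈R⌉₊).choose ⌈R⌉₊ : ℝ) * ((a : ℝ) / b) ^ j, ?_, ?_⟩
    · refine summable_sum fun a ha => ?_
      refine summable_choose_mul_geometric_of_norm_lt_one _ ?_
      rw [Real.norm_of_nonneg (by positivity), div_lt_one hb0]
      exact_mod_cast hAb a ha
    · intro j s hs
      refine (norm_sum_le _ _).trans (Finset.sum_le_sum fun a _ => ?_)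
      rw [norm_mul, norm_pow, norm_div, Complex.norm_natCast, Complex.norm_natCast]
      gcongr
      exact norm_negChoose_le (hs.trans (Nat.le_ceil R)) j

theorem hasSum_negChoose {x : ℂ} (hx : ‖x‖ < 1) (s : ℂ) :
    HasSum (fun j => negChoose j s * x ^ j) ((1 + x) ^ (-s)) := by
  have h := (Complex.one_add_cpow_hasFPowerSeriesOnBall_zero (a := -s)).hasSum (y := x)
    (by simpa [Metric.mem_eball, edist_zero_right, enorm_eq_nnnorm, ← NNReal.coe_lt_coe] using hx)
  simpa [negChoose_eq, List.prod_ofFn,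
    -FormalMultilinearSeries.apply_eq_prod_smul_coeff, mul_comm] using h

theorem sum_cpow_eq (hb : 1 < b) (hAb : ∀ a ∈ A, a < b) {m : ℕ} (hm : 0 < m) (s : ℂ) :
    ∑ a ∈ A, ((a + b * m : ℕ) : ℂ) ^ (-s) = (b : ℂ) ^ (-s) * term (digitCoeff b A) m s := by
  have hb0 : 0 < b := by omega
  have key : ∀ a ∈ A, ((a + b * m : ℕ) : ℂ) ^ (-s) =
      (b : ℂ) ^ (-s) * ((m : ℂ) ^ (-s) *
        ∑' j, negChoose j s * ((a : ℂ) / b) ^ j * ((m : ℂ)⁻¹) ^ j) ∧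
      Summable fun j => negChoose j s * ((a : ℂ) / b) ^ j * ((m : ℂ)⁻¹) ^ j := by
    intro a ha
    have hx : ‖(a : ℂ) / b * (m : ℂ)⁻¹‖ < 1 := by
      rw [norm_mul, norm_div, norm_inv, Complex.norm_natCast, Complex.norm_natCast,
        Complex.norm_natCast, ← div_eq_mul_inv, div_div, div_lt_one (by positivity)]
      have := hAb a ha
      exact_mod_cast this.trans_le (Nat.le_mul_of_pos_right b hm)
    have h := hasSum_negChoose hx s
    simp only [mul_pow, ← mul_assoc] at h
    refine ⟨?_, h.summable⟩
    rw [h.tsum_eq, ← mul_assoc, ← Complex.natCast_mul_natCast_cpow]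
    have e1 : (1 + (a : ℂ) / b * (m : ℂ)⁻¹) = ((1 + (a : ℝ) / b * (m : ℝ)⁻¹ : ℝ) : ℂ) := by
      push_cast; ring
    have e2 : ((b : ℂ) * m) = ((b * m : ℝ) : ℂ) := by push_cast; ring
    -- Principal powers are multiplicative here because both bases are non-negative reals.
    rw [e1, e2, ← Complex.mul_cpow_ofReal_nonneg (by positivity) (by positivity)]
    congr 1
    have : (b : ℂ) ≠ 0 := by exact_mod_cast hb0.ne'
    have : (m : ℂ) ≠ 0 := by exact_mod_cast hm.ne'
    push_cast
    field_simp
    ring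
  rw [term, Finset.sum_congr rfl fun a ha => (key a ha).1, ← Finset.mul_sum, ← Finset.mul_sum,
    ← Summable.tsum_finsetSum fun a ha => (key a ha).2]
  simp only [digitCoeff, Finset.sum_mul]

/-! ### Functional equation -/

/-- The sum of `a ^ (-s)` over the non-zero digits. -/
noncomputable def digitSum (A : Finset ℕ) (s : ℂ) : ℂ := ∑ a ∈ A.erase 0, (a : ℂ) ^ (-s)

theorem differentiable_digitSum : Differentiable ℂ (digitSum A) := by
  unfold digitSum
  refine Differentiable.fun_sum fun a ha s => ?_
  exact (differentiableAt_id.neg).const_cpow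
    (.inl (by exact_mod_cast (Finset.ne_of_mem_erase ha)))

theorem series_unitCoeff_eq (hb : 1 < b) (hAb : ∀ a ∈ A, a < b) (hA : 0 < A.card) {s : ℂ}
    (hs : Real.logb b A.card < s.re) :
    series b A unitCoeff s =
      digitSum A s + (b : ℂ) ^ (-s) * series b A (digitCoeff b A) s := by
  have h1 := (tendsto_sum_upTo hb (F := fun n => term unitCoeff n s)
    (isCoeff_unitCoeff.summable_term hb hAb hA hs)).comp (tendsto_add_atTop_nat 1)
  have h2 := ((tendsto_sum_upTo hb (F := fun n => term (digitCoeff b A) n s)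
    ((isCoeff_digitCoeff hb hAb).summable_term hb hAb hA hs)).const_mul
      ((b : ℂ) ^ (-s))).const_add (digitSum A s)
  refine tendsto_nhds_unique h1 (h2.congr fun l => ?_)
  simp only [Function.comp_apply, sum_upTo_succ hb hAb, term_unitCoeff, digitSum, Finset.mul_sum]
  congr 1
  exact Finset.sum_congr rfl fun m hm => (sum_cpow_eq hb hAb (mem_upTo.1 hm).2.1 s).symm

/-- The function `1 - N b ^ (-s)`, which vanishes at the points `poleZero b A k`. -/
noncomputable def denom (b : ℕ) (A : Finset ℕ) (s : ℂ) : ℂ := 1 - A.card * (b : ℂ) ^ (-s)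

/-- The product of the Dirichlet series and `denom`, on the half-plane `Re s > log_b N - 1`. -/
noncomputable def numer (b : ℕ) (A : Finset ℕ) (s : ℂ) : ℂ :=
  digitSum A s + (b : ℂ) ^ (-s) * series b A (shift (digitCoeff b A)) (s + 1)

theorem differentiable_natCast_cpow_neg (hb : 1 < b) :
    Differentiable ℂ fun s : ℂ => (b : ℂ) ^ (-s) := fun _ =>
  (differentiableAt_id.neg).const_cpow (.inl (by exact_mod_cast (show b ≠ 0 by omega)))

theorem differentiable_denom (hb : 1 < b) : Differentiable ℂ (denom b A) :=
  ((differentiable_natCast_cpow_neg hb).const_mul _).const_sub _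

theorem denom_ne_zero (hb : 1 < b) (hA : 0 < A.card) {s : ℂ} (hs : Real.logb b A.card < s.re) :
    denom b A s ≠ 0 := by
  intro h
  have h1 := card_mul_rpow_lt_one hb hA hs
  have h2 := congrArg norm (sub_eq_zero.1 h)
  rw [norm_one, norm_mul, Complex.norm_natCast, Complex.norm_natCast_cpow_of_pos (by omega),
    Complex.neg_re] at h2
  linarith

theorem denom_mul_series (hb : 1 < b) (hAb : ∀ a ∈ A, a < b) (hA : 0 < A.card) {s : ℂ}
    (hs : Real.logb b A.card < s.re) :
    denom b A s * series b A unitCoeff s = numer b A s := by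
  have h1 := series_unitCoeff_eq hb hAb hA hs
  rw [(isCoeff_digitCoeff hb hAb).series_eq hb hAb hA hs, digitCoeff_zero] at h1
  rw [denom, numer]
  linear_combination h1

/-! ### Meromorphic continuation -/

/-- The continuation of `series b A c` to the half-plane `Re s > log_b N - n`. -/
noncomputable def continuation (b : ℕ) (A : Finset ℕ) : ℕ → (ℕ → ℂ → ℂ) → ℂ → ℂ
  | 0, c, s => series b A c s
  | n + 1, c, s =>
    c 0 s * ((digitSum A s + (b : ℂ) ^ (-s) *
      continuation b A n (shift (digitCoeff b A)) (s + 1)) / denom b A s) +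
      continuation b A n (shift c) (s + 1)

theorem isOpen_re_gt (σ : ℝ) : IsOpen {s : ℂ | σ < s.re} :=
  isOpen_lt continuous_const Complex.continuous_re

theorem meromorphicAt_continuation (hb : 1 < b) (hAb : ∀ a ∈ A, a < b) (hA : 0 < A.card) (n : ℕ)
    {c : ℕ → ℂ → ℂ} (hc : IsCoeff c) {s : ℂ} (hs : Real.logb b A.card - n < s.re) :
    MeromorphicAt (continuation b A n c) s := by
  induction n generalizing c s with
  | zero =>
    have hs' : Real.logb b A.card < s.re := by simpa using hs
    exact ((hc.differentiableOn_series hb hAb hA).analyticAt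
      ((isOpen_re_gt _).mem_nhds hs')).meromorphicAt
  | succ n ih =>
    have hs' : Real.logb b A.card - n < (s + 1).re := by
      push_cast at hs
      simp only [Complex.add_re, Complex.one_re]
      linarith
    have hshift : ∀ {c : ℕ → ℂ → ℂ}, IsCoeff c →
        MeromorphicAt (fun s => continuation b A n (shift c) (s + 1)) s := fun hc =>
      (ih hc.shift hs').comp_analyticAt (g := fun s => s + 1) (by fun_prop)
    have h1 := (differentiable_digitSum (A := A)).analyticAt s |>.meromorphicAt
    have h2 := (differentiable_natCast_cpow_neg hb).analyticAt s |>.meromorphicAt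
    have h3 := (differentiable_denom (A := A) hb).analyticAt s |>.meromorphicAt
    have h4 := (hc.differentiable 0).analyticAt s |>.meromorphicAt
    exact (h4.mul ((h1.add (h2.mul (hshift (isCoeff_digitCoeff hb hAb)))).div h3)).add (hshift hc)

/-- Only `n = 0` has content: there it is the functional equation divided by the non-vanishing
`denom`. Higher `n` follow since both sides unfold to the same recursion at `s + 1`. -/
theorem continuation_succ_eq (hb : 1 < b) (hAb : ∀ a ∈ A, a < b) (hA : 0 < A.card) (n : ℕ)
    {c : ℕ → ℂ → ℂ} (hc : IsCoeff c) {s : ℂ} (hs : Real.logb b A.card - n < s.re) :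
    continuation b A (n + 1) c s = continuation b A n c s := by
  induction n generalizing c s with
  | zero =>
    have hs' : Real.logb b A.card < s.re := by simpa using hs
    have h := denom_mul_series hb hAb hA hs'
    simp only [continuation]
    rw [hc.series_eq hb hAb hA hs', ← numer, ← h, mul_div_cancel_left₀ _ (denom_ne_zero hb hA hs')]
  | succ n ih =>
    have hs' : Real.logb b A.card - n < (s + 1).re := by
      push_cast at hs
      simp only [Complex.add_re, Complex.one_re]
      linarith
    rw [continuation, ih (isCoeff_digitCoeff hb hAb).shift hs', ih hc.shift hs', ← continuation]

theorem continuation_eq_of_le (hb : 1 < b) (hAb : ∀ a ∈ A, a < b) (hA : 0 < A.card) {n m : ℕ}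
    (hnm : n ≤ m) {c : ℕ → ℂ → ℂ} (hc : IsCoeff c) {s : ℂ} (hs : Real.logb b A.card - n < s.re) :
    continuation b A m c s = continuation b A n c s := by
  induction m, hnm using Nat.le_induction with
  | base => rfl
  | succ m hm ih =>
    rw [continuation_succ_eq hb hAb hA m hc, ih]
    have : (n : ℝ) ≤ m := by exact_mod_cast hm
    linarith

/-- The meromorphic continuation of the Dirichlet series to the complex plane. -/
noncomputable def meromorphicContinuation (b : ℕ) (A : Finset ℕ) (s : ℂ) : ℂ :=
  continuation b A (⌊Real.logb b A.card - s.re⌋₊ + 1) unitCoeff s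

theorem meromorphicContinuation_eq (hb : 1 < b) (hAb : ∀ a ∈ A, a < b) (hA : 0 < A.card) {n : ℕ}
    {s : ℂ} (hs : Real.logb b A.card - n < s.re) :
    meromorphicContinuation b A s = continuation b A n unitCoeff s := by
  rw [meromorphicContinuation]
  have h1 := Nat.lt_floor_add_one (Real.logb b A.card - s.re)
  rcases le_total n (⌊Real.logb b A.card - s.re⌋₊ + 1) with h | h
  · exact continuation_eq_of_le hb hAb hA h isCoeff_unitCoeff hs
  · refine (continuation_eq_of_le hb hAb hA h isCoeff_unitCoeff ?_).symm
    push_cast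
    linarith

theorem isMeromorphicContinuation (hb : 1 < b) (hAb : ∀ a ∈ A, a < b) (hA : 0 < A.card) :
    IsMeromorphicContinuation b A (meromorphicContinuation b A) := by
  refine ⟨fun s => ?_, fun s hs => ?_⟩
  · obtain ⟨n, hn⟩ := exists_nat_gt (Real.logb b A.card - s.re)
    have hs : Real.logb b A.card - n < s.re := by linarith
    refine (meromorphicAt_continuation hb hAb hA n isCoeff_unitCoeff hs).congr ?_
    filter_upwards [nhdsWithin_le_nhds ((isOpen_re_gt _).mem_nhds hs)] with w hw
    exact (meromorphicContinuation_eq hb hAb hA hw).symm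
  · rw [meromorphicContinuation_eq hb hAb hA (n := 0) (by simpa using hs)]
    simp only [← term_unitCoeff]
    exact (isCoeff_unitCoeff.summable_term hb hAb hA hs).hasSum

/-! ### Residues and block sums -/

theorem hasResidueAt_of_eventuallyEq_div {f g h : ℂ → ℂ} {z : ℂ} (hg : AnalyticAt ℂ g z)
    (hh : AnalyticAt ℂ h z) (hz : h z = 0) (hz' : deriv h z ≠ 0)
    (hf : f =ᶠ[𝓝[≠] z] fun w => g w / h w) : HasResidueAt f z ((deriv h z)⁻¹ * g z) := by
  refine ⟨(hg.meromorphicAt.div hh.meromorphicAt).congr hf.symm, ?_⟩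
  have hnhds : {w | AnalyticAt ℂ h w} ∈ 𝓝 z := hh.eventually_analyticAt
  -- Writing `h w = (w - z) * dslope h z w` reduces the claim to Cauchy's formula for `g / dslope h
  -- z`, whose denominator at `z` is `deriv h z`.
  have hd : AnalyticAt ℂ (dslope h z) z :=
    ((Complex.differentiableOn_dslope hnhds).2 fun w hw =>
      (show AnalyticAt ℂ h w from hw).differentiableAt.differentiableWithinAt).analyticAt hnhds
  have hG : AnalyticAt ℂ (fun w => g w / dslope h z w) z :=
    hg.div hd (by rwa [dslope_same])
  obtain ⟨ρ, hρ, hball⟩ := Metric.eventually_nhds_iff_ball.1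
    (hG.eventually_analyticAt.and (eventually_nhdsWithin_iff.1 hf))
  filter_upwards [Ioo_mem_nhdsGT hρ] with r hr
  have hsub : Metric.closedBall z r ⊆ Metric.ball z ρ := Metric.closedBall_subset_ball hr.2
  have h1 : (∮ w in C(z, r), f w) = ∮ w in C(z, r), (w - z)⁻¹ • (g w / dslope h z w) := by
    refine circleIntegral.integral_congr hr.1.le fun w hw => ?_
    have hwz : w ≠ z := by
      rintro rfl
      simp [hr.1.ne] at hw
    have := sub_smul_dslope h z w
    rw [hz, sub_zero, smul_eq_mul] at this
    simp only [(hball w (hsub (Metric.sphere_subset_closedBall hw))).2 hwz, ← this, smul_eq_mul]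
    rw [div_mul_eq_div_div, div_div, mul_comm (w - z), ← div_div, div_eq_inv_mul _ (w - z)]
  rw [h1, DifferentiableOn.circleIntegral_sub_inv_smul (fun w hw =>
    (hball w (hsub hw)).1.differentiableAt.differentiableWithinAt) (Metric.mem_ball_self hr.1),
    dslope_same, smul_eq_mul, div_eq_inv_mul]

theorem poleZero_re (k : ℤ) : (poleZero b A k).re = Real.logb b A.card := by
  have : poleZero b A k =
      (Real.logb b A.card : ℂ) + ((2 * Real.pi * k / Real.log b : ℝ) : ℂ) * Complex.I := by
    rw [poleZero]; push_cast; ring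
  rw [this, Complex.add_re, Complex.ofReal_re, Complex.re_ofReal_mul, Complex.I_re, mul_zero,
    add_zero]

theorem card_mul_cpow_poleZero (hb : 1 < b) (hA : 0 < A.card) (k : ℤ) :
    A.card * (b : ℂ) ^ (-poleZero b A k) = 1 := by
  have hb0 : (b : ℂ) ≠ 0 := by exact_mod_cast (show b ≠ 0 by omega)
  have hN : (A.card : ℂ) ≠ 0 := by exact_mod_cast hA.ne'
  have hlog : (Real.log b : ℂ) ≠ 0 := by
    exact_mod_cast (Real.log_pos (by exact_mod_cast hb)).ne'
  have h : (b : ℂ) ^ poleZero b A k = A.card := by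
    rw [Complex.cpow_def_of_ne_zero hb0, ← Complex.natCast_log, poleZero, Real.logb]
    have key : ∀ x y : ℝ, (x : ℂ) ≠ 0 → (x : ℂ) * (((y / x : ℝ) : ℂ) +
        2 * Real.pi * Complex.I * k / x) = y + k * (2 * Real.pi * Complex.I) := by
      intro x y hx
      push_cast
      field_simp
    rw [key _ _ hlog, Complex.exp_add, Complex.exp_int_mul_two_pi_mul_I, mul_one, Complex.natCast_log,
      Complex.exp_log hN]
  rw [Complex.cpow_neg, h, mul_inv_cancel₀ hN]

theorem hasDerivAt_denom (hb : 1 < b) (hA : 0 < A.card) (k : ℤ) :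
    HasDerivAt (denom b A) (Real.log b) (poleZero b A k) := by
  have hb0 : (b : ℂ) ≠ 0 := by exact_mod_cast (show b ≠ 0 by omega)
  have h := ((((hasDerivAt_id (poleZero b A k)).neg).const_cpow (c := (b : ℂ))
    (.inl hb0)).const_mul (A.card : ℂ)).const_sub 1
  refine HasDerivAt.congr_deriv (f := denom b A) h ?_
  have := card_mul_cpow_poleZero hb hA k
  simp only [Pi.neg_apply, id_eq, ← Complex.natCast_log]
  linear_combination (Real.log b : ℂ) * this

theorem analyticAt_numer (hb : 1 < b) (hAb : ∀ a ∈ A, a < b) (hA : 0 < A.card) {s : ℂ}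
    (hs : Real.logb b A.card < s.re + 1) : AnalyticAt ℂ (numer b A) s := by
  have h := ((isCoeff_digitCoeff hb hAb).shift.differentiableOn_series hb hAb hA).analyticAt
    ((isOpen_re_gt _).mem_nhds (show Real.logb b A.card < (s + 1).re by simpa using hs))
  exact (differentiable_digitSum.analyticAt s).add
    (((differentiable_natCast_cpow_neg hb).analyticAt s).mul
      (h.fun_comp (g := series b A (shift (digitCoeff b A))) (f := fun s => s + 1) (by fun_prop)))

theorem tendsto_sum_block (hb : 1 < b) (hAb : ∀ a ∈ A, a < b) (hA : 0 < A.card) (k : ℤ) :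
    Tendsto (fun l => ∑ n ∈ block b A l, (n : ℂ) ^ (-poleZero b A k)) atTop
      (𝓝 (numer b A (poleZero b A k))) := by
  set s := poleZero b A k with hs
  have hg := isCoeff_digitCoeff hb hAb
  have hsum := hg.shift.summable_term hb hAb hA (s := s + 1) (by simp [hs, poleZero_re])
  rw [← tendsto_add_atTop_iff_nat 1]
  refine (((tendsto_sum_upTo hb (F := fun n => term (shift (digitCoeff b A)) n (s + 1))
    hsum).const_mul ((b : ℂ) ^ (-s))).const_add (digitSum A s)).congr fun l => ?_
  have h1 := sum_upTo_succ_eq_add_block (A := A) hb (fun n => (n : ℂ) ^ (-s)) l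
  rw [sum_upTo_succ hb hAb] at h1
  have h2 : ∑ m ∈ upTo b A l, ∑ a ∈ A, ((a + b * m : ℕ) : ℂ) ^ (-s) =
      ∑ m ∈ upTo b A l, (m : ℂ) ^ (-s) +
        (b : ℂ) ^ (-s) * ∑ m ∈ upTo b A l, term (shift (digitCoeff b A)) m (s + 1) := by
    rw [Finset.mul_sum, ← Finset.sum_add_distrib]
    refine Finset.sum_congr rfl fun m hm => ?_
    have hm0 := (mem_upTo.1 hm).2.1
    rw [sum_cpow_eq hb hAb hm0, hg.term_eq hm0, digitCoeff_zero]
    -- Since `N b ^ (-s) = 1`, the leading term is exactly `m ^ (-s)`; it cancels when consecutive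
    -- partial sums are subtracted.
    linear_combination (m : ℂ) ^ (-s) * card_mul_cpow_poleZero hb hA k
  rw [digitSum]
  linear_combination h1 - h2

theorem hasResidueAt_poleZero (hb : 1 < b) (hAb : ∀ a ∈ A, a < b) (hA : 0 < A.card) {K : ℂ → ℂ}
    (hK : IsMeromorphicContinuation b A K) (k : ℤ) :
    HasResidueAt K (poleZero b A k) ((Real.log b : ℂ)⁻¹ * numer b A (poleZero b A k)) := by
  set z := poleZero b A k with hz
  have hzre : z.re = Real.logb b A.card := poleZero_re k
  have hnum : AnalyticAt ℂ (numer b A) z := analyticAt_numer hb hAb hA (by linarith)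
  have hden : AnalyticAt ℂ (denom b A) z := (differentiable_denom hb).analyticAt z
  have hderiv := hasDerivAt_denom hb hA k
  have hlog : (Real.log b : ℂ) ≠ 0 := by
    exact_mod_cast (Real.log_pos (by exact_mod_cast hb)).ne'
  have hmul : ∀ s : ℂ, Real.logb b A.card < s.re → denom b A s * K s - numer b A s = 0 := by
    intro s hs
    have hKs : K s = series b A unitCoeff s := by
      rw [← (hK.2 s hs).tsum_eq, series]
      simp only [term_unitCoeff]
    rw [hKs, denom_mul_series hb hAb hA hs, sub_self]
  -- Points to the right of `z` lie in the half-plane of convergence; the identity principle for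
  -- meromorphic functions then extends the functional equation to a punctured neighbourhood, for an
  -- arbitrary continuation `K`.
  have hfreq : ∃ᶠ s in 𝓝[≠] z, denom b A s * K s - numer b A s = 0 := by
    have ht : Tendsto (fun t : ℝ => z + t) (𝓝[>] 0) (𝓝[≠] z) := by
      refine tendsto_nhdsWithin_iff.2 ⟨?_, ?_⟩
      · have : Continuous fun t : ℝ => z + t := by fun_prop
        simpa using (this.tendsto 0).mono_left nhdsWithin_le_nhds
      · filter_upwards [self_mem_nhdsWithin] with t ht
        simpa using (show (0 : ℝ) < t from ht).ne'
    refine ht.frequently (Eventually.frequently ?_)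
    filter_upwards [self_mem_nhdsWithin] with t ht
    refine hmul _ ?_
    simpa [hzre] using ht
  have hmer : MeromorphicAt (fun s => denom b A s * K s - numer b A s) z :=
    (hden.meromorphicAt.mul (hK.1 z)).sub hnum.meromorphicAt
  have hzero : ∀ᶠ s in 𝓝[≠] z, denom b A s * K s - numer b A s = 0 :=
    hmer.eventually_eq_zero_or_eventually_ne_zero.resolve_right fun h =>
      hfreq (h.mono fun _ h => h)
  have h := hasResidueAt_of_eventuallyEq_div (f := K) hnum hden
    (sub_eq_zero.2 (card_mul_cpow_poleZero hb hA k).symm) (by rwa [hderiv.deriv]) (by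
      filter_upwards [hzero, hderiv.eventually_ne (c := 0) hlog] with s h1 h2
      rw [eq_div_iff h2]
      linear_combination h1)
  rwa [hderiv.deriv] at h

end RestrictedDirichlet

theorem mainTheorem6 (b : ℕ) (hb : 1 < b) (A : Finset ℕ) (hAb : ∀ a ∈ A, a < b)
    (hA : ∃ a ∈ A, a ≠ 0) :
    (∃ K : ℂ → ℂ, RestrictedDirichlet.IsMeromorphicContinuation b A K) ∧
    ∀ K : ℂ → ℂ, RestrictedDirichlet.IsMeromorphicContinuation b A K →
      ∀ k : ℤ, ∃ L : ℂ,
        Tendsto (fun l : ℕ => ∑ n ∈ RestrictedDirichlet.block b A l,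
          (n : ℂ) ^ (-RestrictedDirichlet.poleZero b A k)) atTop (𝓝 L) ∧
        RestrictedDirichlet.HasResidueAt K (RestrictedDirichlet.poleZero b A k)
          ((Real.log b : ℂ)⁻¹ * L) := by
  have hcard : 0 < A.card := Finset.card_pos.2 (hA.imp fun _ h => h.1)
  exact ⟨⟨_, RestrictedDirichlet.isMeromorphicContinuation hb hAb hcard⟩, fun K hK k =>
    ⟨_, RestrictedDirichlet.tendsto_sum_block hb hAb hcard k,
      RestrictedDirichlet.hasResidueAt_poleZero hb hAb hcard hK k⟩⟩
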